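/- **Proposition (Cotton gravity, linear electrodynamics).** Let $I\subseteq(0,\infty)$ be an open interval, let $B:I\to(0,\infty)$ be of class $C^3$, and consider the static spherical metric $$ds^2=-B(r)\,dt^2+\frac{dr^2}{B(r)}+r^2(d\theta^2+\sin^2\theta\,d\phi^2),\qquad r\in I,\ 0<\theta<\pi .$$ Let $u_k=(-\sqrt{B},0,0,0)$ be the velocity, $n_k=(0,\varepsilon/\sqrt{B},0,0)$ with a fixed sign $\varepsilon=\pm1$ the unit radial covector (it equals the normalised acceleration $\dot u_k/\sqrt{\eta}$, where $\dot u_k=u^j\nabla_j u_k$ and $\eta=\dot u^k\dot u_k$, wherever $\varepsilon B'>0$), and let $y_k=(0,0,r,0)$, $z_k=(0,0,0,r\sin\theta)$. For functions $\mathbb E,\mathbb B:I\to\mathbb R$ of class $C^1$ put $$F_{jk}=\mathbb E(r)\,(u_jn_k-n_ju_k)+\mathbb B(r)\,(y_jz_k-y_kz_j),\qquad T_{jk}=2F_{jm}F_k{}^m-\tfrac12\,g_{jk}F_{ab}F^{ab},$$ the latter being the energy-momentum tensor of linear electrodynamics. Let $R_{jk}$ be the Ricci tensor, $R$ the scalar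 curvature, and $$C_{jkl}=\nabla_jR_{kl}-\nabla_kR_{jl}-\tfrac16(g_{kl}\nabla_jR-g_{jl}\nabla_kR)$$ the Cotton tensor. Then $F$ satisfies the Faraday identity $$\nabla_jF_{kl}+\nabla_kF_{lj}+\nabla_lF_{jk}=0$$ and the Cotton gravity (Harada) field equation $$C_{jkl}=\nabla_jT_{kl}-\nabla_kT_{jl}-\tfrac13(g_{kl}\nabla_jT-g_{jl}\nabla_kT),\qquad T=T^k{}_k,$$ holds for all $r\in I$, $0<\theta<\pi$, if and only if there are real constants $q_e,q_m,M,\Lambda,\gamma$ such that for all $r\in I$ $$\mathbb E(r)=\frac{q_e}{r^2},\qquad \mathbb B(r)=\frac{q_m}{r^2},\qquad B(r)=1-\frac{2M}{r}-\frac{\Lambda}{3}r^2+\gamma r+\frac{q_e^2+q_m^2}{r^2}.$$ In particular the electric field is forced to be Coulomb. -/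

import Mathlib

/-- A point of a coordinate chart on a four-dimensional spacetime. In the static spherical chart the
coordinates are `(x 0, x 1, x 2, x 3) = (t, r, θ, φ)`. -/
abbrev Point : Type := Fin 4 → ℝ

/-- A covector field (one lower index), by its coordinate components. -/
abbrev Covector : Type := Point → Fin 4 → ℝ

/-- A field of rank-two covariant tensors, by its coordinate components. -/
abbrev Tensor₂ : Type := Point → Matrix (Fin 4) (Fin 4) ℝ

noncomputable section

namespace CottonGravity

/-- The partial derivative `∂_j f` at `x`. -/
def pd (j : Fin 4) (f : Point → ℝ) (x : Point) : ℝ :=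
  deriv (fun s : ℝ => f (Function.update x j s)) (x j)

/-! ### Tensor calculus of a metric given by its components in a chart -/

/-- Christoffel symbols `Γ^i_{jk}` of the Levi-Civita connection; `(g x)⁻¹` is `g^{ij}`. -/
def christoffel (g : Tensor₂) (i j k : Fin 4) (x : Point) : ℝ :=
  (1 / 2) * ∑ m, (g x)⁻¹ i m *
    (pd j (fun p => g p m k) x + pd k (fun p => g p m j) x - pd m (fun p => g p j k) x)

/-- `∇_j v_k`. -/
def covDeriv₁ (g : Tensor₂) (v : Covector) (j k : Fin 4) (x : Point) : ℝ :=
  pd j (fun p => v p k) x - ∑ m, christoffel g m j k x * v x m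

/-- `∇_j S_{kl}`. -/
def covDeriv₂ (g : Tensor₂) (S : Tensor₂) (j k l : Fin 4) (x : Point) : ℝ :=
  pd j (fun p => S p k l) x - ∑ m, christoffel g m j k x * S x m l
    - ∑ m, christoffel g m j l x * S x k m

/-- The Ricci tensor `R_{jk} = ∂_m Γ^m_{jk} - ∂_k Γ^m_{jm} + Γ^m_{ma} Γ^a_{jk} - Γ^m_{ka} Γ^a_{jm}`
(the sign for which round spheres have positive Ricci curvature). -/
def ricci (g : Tensor₂) : Tensor₂ := fun x => Matrix.of fun j k =>
  ∑ m, (pd m (christoffel g m j k) x - pd k (christoffel g m j m) x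
    + ∑ a, (christoffel g m m a x * christoffel g a j k x
      - christoffel g m k a x * christoffel g a j m x))

/-- The trace `S^k_k = g^{jk} S_{jk}`. -/
def metricTrace (g : Tensor₂) (S : Tensor₂) (x : Point) : ℝ :=
  ∑ j, ∑ k, (g x)⁻¹ j k * S x j k

/-- The Cotton tensor
`C_{jkl} = ∇_j R_{kl} - ∇_k R_{jl} - (1/6) (g_{kl} ∇_j R - g_{jl} ∇_k R)` in dimension four. -/
def cotton (g : Tensor₂) (j k l : Fin 4) (x : Point) : ℝ :=
  covDeriv₂ g (ricci g) j k l x - covDeriv₂ g (ricci g) k j l x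
    - (1 / 6) * (g x k l * pd j (metricTrace g (ricci g)) x
      - g x j l * pd k (metricTrace g (ricci g)) x)

/-- The field equation of Cotton gravity (Harada's equation) with energy-momentum tensor `T`, on `U`:
`C_{jkl} = ∇_j T_{kl} - ∇_k T_{jl} - (1/3) (g_{kl} ∇_j T - g_{jl} ∇_k T)`, where `T = T^k_k`. -/
def SolvesHarada (g T : Tensor₂) (U : Set Point) : Prop :=
  ∀ x ∈ U, ∀ j k l : Fin 4,
    cotton g j k l x = covDeriv₂ g T j k l x - covDeriv₂ g T k j l x
      - (1 / 3) * (g x k l * pd j (metricTrace g T) x - g x j l * pd k (metricTrace g T) x)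

/-! ### Electrodynamics -/

/-- `F` satisfies the Faraday (Bianchi) identity on `U`:
`∇_j F_{kl} + ∇_k F_{lj} + ∇_l F_{jk} = 0`. -/
def IsFaraday (g F : Tensor₂) (U : Set Point) : Prop :=
  ∀ x ∈ U, ∀ j k l : Fin 4,
    covDeriv₂ g F j k l x + covDeriv₂ g F k l j x + covDeriv₂ g F l j k x = 0

/-- The invariant `(1/4) F_{jk} F^{jk}`. -/
def fieldInvariant (g F : Tensor₂) (x : Point) : ℝ :=
  (1 / 4) * ∑ j, ∑ k, ∑ a, ∑ b, (g x)⁻¹ j a * (g x)⁻¹ k b * F x j k * F x a b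

/-- The energy-momentum tensor of linear electrodynamics,
`T_{jk} = 2 F_{jm} F_k^m - 2 g_{jk} (1/4) F_{ab} F^{ab}`. -/
def linearEM (g F : Tensor₂) : Tensor₂ := fun x => Matrix.of fun j k =>
  2 * ∑ m, ∑ a, (g x)⁻¹ m a * F x j m * F x k a - 2 * g x j k * fieldInvariant g F x

/-! ### Static spherical symmetry -/

/-- The part of the chart `(t, r, θ, φ)` over the radial interval `I`. -/
def chart (I : Set ℝ) : Set Point := {x | x 1 ∈ I ∧ x 2 ∈ Set.Ioo 0 Real.pi}

/-- `ds² = -B(r) dt² + dr²/B(r) + r² (dθ² + sin²θ dφ²)`. -/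
def staticMetric (B : ℝ → ℝ) : Tensor₂ := fun x =>
  Matrix.diagonal ![-B (x 1), 1 / B (x 1), x 1 ^ 2, x 1 ^ 2 * Real.sin (x 2) ^ 2]

/-- The velocity `u_k = (-√B, 0, 0, 0)`. -/
def velocity (B : ℝ → ℝ) : Covector := fun x => ![-√(B (x 1)), 0, 0, 0]

/-- The unit radial covector `n_k = (0, ε/√B, 0, 0)`, `ε = ±1`. It is the normalised acceleration
`u̇_k / √η` wherever the latter is defined and `ε` is the sign of `B'`; see
`acceleration_eq_sqrt_mul_radial`. -/
def radial (ε : ℝ) (B : ℝ → ℝ) : Covector := fun x => ![0, ε / √(B (x 1)), 0, 0]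

/-- The unit angular covector `y_k = (0, 0, r, 0)`. -/
def angularY : Covector := fun x => ![0, 0, x 1, 0]

/-- The unit angular covector `z_k = (0, 0, 0, r sin θ)`. -/
def angularZ : Covector := fun x => ![0, 0, 0, x 1 * Real.sin (x 2)]

/-- `F_{jk} = E (u_j n_k - n_j u_k) + H (y_j z_k - y_k z_j)` with electric coefficient `E(r)` and
magnetic coefficient `H(r)`. -/
def faradayTensor (ε : ℝ) (B E H : ℝ → ℝ) : Tensor₂ := fun x => Matrix.of fun j k =>
  E (x 1) * (velocity B x j * radial ε B x k - radial ε B x j * velocity B x k)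
    + H (x 1) * (angularY x j * angularZ x k - angularY x k * angularZ x j)

/-- The acceleration `u̇_k = u^j ∇_j u_k`. -/
def acceleration (B : ℝ → ℝ) : Covector := fun x k =>
  ∑ j, ∑ a, (staticMetric B x)⁻¹ j a * velocity B x a * covDeriv₁ (staticMetric B) (velocity B) j k x

/-- The squared norm of the acceleration, `η = u̇^k u̇_k`. -/
def accelerationSq (B : ℝ → ℝ) (x : Point) : ℝ :=
  ∑ j, ∑ k, (staticMetric B x)⁻¹ j k * acceleration B x j * acceleration B x k

theorem staticMetric_inv {B : ℝ → ℝ} {x : Point} (hr : x 1 ≠ 0) (hs : Real.sin (x 2) ≠ 0)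
    (hB : B (x 1) ≠ 0) : (staticMetric B x)⁻¹ = Matrix.diagonal
      ![-(B (x 1))⁻¹, B (x 1), (x 1 ^ 2)⁻¹, (x 1 ^ 2 * Real.sin (x 2) ^ 2)⁻¹] := by
  apply Matrix.inv_eq_right_inv
  rw [staticMetric, Matrix.diagonal_mul_diagonal, ← Matrix.diagonal_one]
  congr 1
  funext k
  fin_cases k <;> simp <;> field_simp

/-- `u̇_k = (0, B'/(2B), 0, 0)`. -/
theorem acceleration_eq {B : ℝ → ℝ} {x : Point} (hr : 0 < x 1) (hθ : x 2 ∈ Set.Ioo 0 Real.pi)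
    (hB : 0 < B (x 1)) : acceleration B x = ![0, deriv B (x 1) / (2 * B (x 1)), 0, 0] := by
  have hs : Real.sin (x 2) ≠ 0 := (Real.sin_pos_of_pos_of_lt_pi hθ.1 hθ.2).ne'
  have hq : √(B (x 1)) ≠ 0 := (Real.sqrt_pos.2 hB).ne'
  have hqq : √(B (x 1)) ^ 2 = B (x 1) := Real.sq_sqrt hB.le
  have hinv := staticMetric_inv hr.ne' hs hB.ne'
  funext k
  simp only [acceleration, covDeriv₁, christoffel, pd, hinv]
  fin_cases k <;>
    simp [Fin.sum_univ_four, velocity, staticMetric, Matrix.diagonal, Function.update]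
  field_simp
  rw [hqq]

/-- Where `ε` has the sign of `B'`, the acceleration is `u̇_k = √η n_k`. -/
theorem acceleration_eq_sqrt_mul_radial {B : ℝ → ℝ} {x : Point} {ε : ℝ} (hr : 0 < x 1)
    (hθ : x 2 ∈ Set.Ioo 0 Real.pi) (hB : 0 < B (x 1)) (hε : ε = 1 ∨ ε = -1)
    (hs : 0 ≤ ε * deriv B (x 1)) (k : Fin 4) :
    acceleration B x k = √(accelerationSq B x) * radial ε B x k := by
  have hq : √(B (x 1)) ≠ 0 := (Real.sqrt_pos.2 hB).ne'
  have hqq : √(B (x 1)) ^ 2 = B (x 1) := Real.sq_sqrt hB.le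
  have hinv := staticMetric_inv hr.ne' (Real.sin_pos_of_pos_of_lt_pi hθ.1 hθ.2).ne' hB.ne'
  have hee : ε ^ 2 = 1 := by rcases hε with h | h <;> simp [h]
  have hη : accelerationSq B x = (ε * deriv B (x 1) / (2 * √(B (x 1)))) ^ 2 := by
    simp [accelerationSq, hinv, acceleration_eq hr hθ hB, Fin.sum_univ_four, Matrix.diagonal,
      mul_pow, div_pow, hee, hqq]
    field_simp
  have hpos : 0 ≤ ε * deriv B (x 1) / (2 * √(B (x 1))) := by positivity
  rw [hη, Real.sqrt_sq hpos, acceleration_eq hr hθ hB]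
  fin_cases k <;> simp [radial]
  field_simp
  rw [hqq, hee, mul_one]

end CottonGravity

end

open CottonGravity

noncomputable section

namespace CottonGravity

/-! The Harada equation says that `A = Ric - T - (R - 2 tr T) g / 6` is a Codazzi tensor: `∇_j A_kl
= ∇_k A_jl`. Here `Ric` has a double eigenvalue `P` on the `(t, r)` plane and `Q` on the sphere,
while `T` is traceless with eigenvalues `-w`, `w`, where `w = E² + H²`. So `A` has eigenvalues `α =
(2P - Q + 3w)/3` and `β = (2Q - P - 3w)/3`, and the equation reduces to `α' = 0`, `r β' = α - β`
(`solvesHarada_block_iff`), that is `α = p`, `β = p + c/r`.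

The source cancels in `α + β = (P + Q)/3`, which leaves a linear equation for `(r² B)''`. Two
integrations give `B` with constants `a`, `b`, and `α = p` then returns `w = b/r⁴`
(`exists_metric_coefficients`).

The Faraday identity only says that `r² H` is a constant `qm` (`isFaraday_static_iff`). Hence `(r²
E)² = b - qm²`, and a differentiable function with constant square on an interval is constant: the
Coulomb law follows without a Maxwell source equation. The converse is a substitution
(`reduced_harada_of_eq`). -/

theorem pd_comp_one_two (f : ℝ → ℝ → ℝ) (j : Fin 4) (x : Point) :
    pd j (fun p => f (p 1) (p 2)) x =
      ![0, deriv (fun r => f r (x 2)) (x 1), deriv (fun θ => f (x 1) θ) (x 2), 0] j := by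
  fin_cases j <;> simp [pd, Function.update]

theorem isOpen_chart {I : Set ℝ} (hI : IsOpen I) : IsOpen (chart I) :=
  (hI.preimage (continuous_apply 1)).inter (isOpen_Ioo.preimage (continuous_apply 2))

/-- The component formulas are valid only on the chart, so differentiating them again needs
agreement on a neighbourhood. -/
theorem pd_congr {U : Set Point} (hU : IsOpen U) {f g : Point → ℝ} (h : ∀ x ∈ U, f x = g x)
    (j : Fin 4) {x : Point} (hx : x ∈ U) : pd j f x = pd j g x := by
  apply Filter.EventuallyEq.deriv_eq
  have hc : Continuous fun s : ℝ => Function.update x j s := continuous_const.update j continuous_id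
  have hmem : (fun s : ℝ => Function.update x j s) ⁻¹' U ∈ nhds (x j) :=
    hc.continuousAt.preimage_mem_nhds (by simpa using hU.mem_nhds hx)
  filter_upwards [hmem] with s hs using h _ hs

/-- Partial derivatives of a field that on an open set depends on `r` and `θ` only. -/
theorem pd_eq_of_hasDerivAt {U : Set Point} (hU : IsOpen U) {f : Point → ℝ} {F : ℝ → ℝ → ℝ}
    (h : ∀ x ∈ U, f x = F (x 1) (x 2)) (j : Fin 4) {x : Point} (hx : x ∈ U) {dr dθ : ℝ}
    (hr : HasDerivAt (fun r => F r (x 2)) dr (x 1)) (hθ : HasDerivAt (fun θ => F (x 1) θ) dθ (x 2)) :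
    pd j f x = ![0, dr, dθ, 0] j := by
  rw [pd_congr hU h j hx, pd_comp_one_two, hr.deriv, hθ.deriv]

theorem covDeriv₂_congr {U : Set Point} (hU : IsOpen U) (g : Tensor₂) {S S' : Tensor₂}
    (h : ∀ x ∈ U, S x = S' x) (j k l : Fin 4) {x : Point} (hx : x ∈ U) :
    covDeriv₂ g S j k l x = covDeriv₂ g S' j k l x := by
  simp only [covDeriv₂, h x hx]
  rw [pd_congr hU (fun y hy => by rw [h y hy]) j hx]

/-! ### Block tensors and the Christoffel symbols -/

/-- The tensor `p` times the `(t, r)` block plus `q` times the `(θ, φ)` block of the metric. -/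
def blockTensor (B p q : ℝ → ℝ) : Tensor₂ := fun x =>
  Matrix.diagonal ![-(B (x 1) * p (x 1)), p (x 1) / B (x 1), x 1 ^ 2 * q (x 1),
    x 1 ^ 2 * Real.sin (x 2) ^ 2 * q (x 1)]

/-- The Christoffel symbols of the static metric, as functions of `b = B(r)`, `b' = B'(r)`, `r`,
`θ`. -/
def staticChristoffel (b b' r θ : ℝ) : Fin 4 → Matrix (Fin 4) (Fin 4) ℝ :=
  ![!![0, b' / (2 * b), 0, 0; b' / (2 * b), 0, 0, 0; 0, 0, 0, 0; 0, 0, 0, 0],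
    !![b * b' / 2, 0, 0, 0; 0, -(b' / (2 * b)), 0, 0; 0, 0, -(r * b), 0;
      0, 0, 0, -(r * b * Real.sin θ ^ 2)],
    !![0, 0, 0, 0; 0, 0, 1 / r, 0; 0, 1 / r, 0, 0; 0, 0, 0, -(Real.sin θ * Real.cos θ)],
    !![0, 0, 0, 0; 0, 0, 0, 1 / r; 0, 0, 0, Real.cos θ / Real.sin θ;
      0, 1 / r, Real.cos θ / Real.sin θ, 0]]

/-- The `r`-derivatives of `staticChristoffel`. -/
def staticChristoffelDr (b b' b'' r θ : ℝ) : Fin 4 → Matrix (Fin 4) (Fin 4) ℝ :=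
  let a := (b'' * b - b' ^ 2) / (2 * b ^ 2)
  ![!![0, a, 0, 0; a, 0, 0, 0; 0, 0, 0, 0; 0, 0, 0, 0],
    !![(b' ^ 2 + b * b'') / 2, 0, 0, 0; 0, -a, 0, 0; 0, 0, -(b + r * b'), 0;
      0, 0, 0, -((b + r * b') * Real.sin θ ^ 2)],
    !![0, 0, 0, 0; 0, 0, -(1 / r ^ 2), 0; 0, -(1 / r ^ 2), 0, 0; 0, 0, 0, 0],
    !![0, 0, 0, 0; 0, 0, 0, -(1 / r ^ 2); 0, 0, 0, 0; 0, -(1 / r ^ 2), 0, 0]]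

/-- The `θ`-derivatives of `staticChristoffel`. -/
def staticChristoffelDθ (b r θ : ℝ) : Fin 4 → Matrix (Fin 4) (Fin 4) ℝ :=
  ![0,
    !![0, 0, 0, 0; 0, 0, 0, 0; 0, 0, 0, 0; 0, 0, 0, -(2 * r * b * Real.sin θ * Real.cos θ)],
    !![0, 0, 0, 0; 0, 0, 0, 0; 0, 0, 0, 0; 0, 0, 0, Real.sin θ ^ 2 - Real.cos θ ^ 2],
    !![0, 0, 0, 0; 0, 0, 0, 0; 0, 0, 0, -(1 / Real.sin θ ^ 2); 0, 0, -(1 / Real.sin θ ^ 2), 0]]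

theorem hasDerivAt_staticChristoffel_r {B B' : ℝ → ℝ} {b'' r θ : ℝ} (hr : r ≠ 0) (hb : B r ≠ 0)
    (hB : HasDerivAt B (B' r) r) (hB' : HasDerivAt B' b'' r) (i j k : Fin 4) :
    HasDerivAt (fun r => staticChristoffel (B r) (B' r) r θ i j k)
      (staticChristoffelDr (B r) (B' r) b'' r θ i j k) r := by
  have h1 : HasDerivAt (fun r => B' r / (2 * B r)) ((b'' * B r - B' r ^ 2) / (2 * B r ^ 2)) r := by
    refine (hB'.div (hB.const_mul 2) (by positivity)).congr_deriv ?_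
    field_simp
  have h2 : HasDerivAt (fun r => B r * B' r / 2) ((B' r ^ 2 + B r * b'') / 2) r := by
    exact ((hB.mul hB').div_const 2).congr_deriv (by ring)
  have h3 : HasDerivAt (fun r => r * B r) (B r + r * B' r) r := by
    exact ((hasDerivAt_id r).mul hB).congr_deriv (by simp)
  have h4 : HasDerivAt (fun r : ℝ => 1 / r) (-(1 / r ^ 2)) r := by
    simpa using hasDerivAt_inv hr
  fin_cases i <;> fin_cases j <;> fin_cases k <;>
    first
      | exact hasDerivAt_const r 0
      | exact h1
      | exact h1.neg
      | exact h2
      | exact h3.neg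
      | exact (h3.mul_const (Real.sin θ ^ 2)).neg
      | exact h4
      | exact hasDerivAt_const r (-(Real.sin θ * Real.cos θ))
      | exact hasDerivAt_const r (Real.cos θ / Real.sin θ)

theorem hasDerivAt_staticChristoffel_θ {b b' r θ : ℝ} (hs : Real.sin θ ≠ 0) (i j k : Fin 4) :
    HasDerivAt (fun θ => staticChristoffel b b' r θ i j k) (staticChristoffelDθ b r θ i j k) θ := by
  have h1 : HasDerivAt (fun θ => -(r * b * Real.sin θ ^ 2))
      (-(2 * r * b * Real.sin θ * Real.cos θ)) θ := by
    exact (((Real.hasDerivAt_sin θ).pow 2).const_mul (r * b)).neg.congr_deriv (by push_cast; ring)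
  have h2 : HasDerivAt (fun θ => -(Real.sin θ * Real.cos θ)) (Real.sin θ ^ 2 - Real.cos θ ^ 2) θ := by
    exact ((Real.hasDerivAt_sin θ).mul (Real.hasDerivAt_cos θ)).neg.congr_deriv (by ring)
  have h3 : HasDerivAt (fun θ => Real.cos θ / Real.sin θ) (-(1 / Real.sin θ ^ 2)) θ := by
    refine ((Real.hasDerivAt_cos θ).div (Real.hasDerivAt_sin θ) hs).congr_deriv ?_
    field_simp
    linarith [Real.sin_sq_add_cos_sq θ]
  fin_cases i <;> fin_cases j <;> fin_cases k <;>
    first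
      | exact hasDerivAt_const θ _
      | exact h1
      | exact h2
      | exact h3

section

variable {I : Set ℝ} {B B' : ℝ → ℝ} {x : Point}

theorem sin_ne_zero_of_mem_chart (hx : x ∈ chart I) : Real.sin (x 2) ≠ 0 :=
  (Real.sin_pos_of_pos_of_lt_pi hx.2.1 hx.2.2).ne'

theorem christoffel_static (hI0 : I ⊆ Set.Ioi 0) (hBpos : ∀ r ∈ I, 0 < B r)
    (hB : ∀ r ∈ I, HasDerivAt B (B' r) r) (hx : x ∈ chart I) (i j k : Fin 4) :
    christoffel (staticMetric B) i j k x =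
      staticChristoffel (B (x 1)) (B' (x 1)) (x 1) (x 2) i j k := by
  have hr : x 1 ≠ 0 := (hI0 hx.1).ne'
  have hs := sin_ne_zero_of_mem_chart hx
  have hb : B (x 1) ≠ 0 := (hBpos _ hx.1).ne'
  have hd := hB _ hx.1
  have hd1 : deriv B (x 1) = B' (x 1) := hd.deriv
  have hd2 : deriv (fun r => (B r)⁻¹) (x 1) = -(B' (x 1)) / B (x 1) ^ 2 := (hd.inv hb).deriv
  simp only [christoffel, pd, staticMetric_inv hr hs hb, Fin.sum_univ_four]
  fin_cases i <;> fin_cases j <;> fin_cases k <;>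
    simp [staticMetric, staticChristoffel, Matrix.diagonal, Function.update, hd1, hd2] <;>
    field_simp

end

/-! ### Ricci tensor and covariant derivatives of block tensors -/

/-- The double eigenvalue of the Ricci tensor of the static metric on the `(t, r)` plane. -/
def ricciRadial (B' B'' : ℝ → ℝ) (r : ℝ) : ℝ := -(B'' r / 2) - B' r / r

/-- The double eigenvalue of the Ricci tensor of the static metric on the angular plane. -/
def ricciAngular (B B' : ℝ → ℝ) (r : ℝ) : ℝ := (1 - B r - r * B' r) / r ^ 2

section

variable {I : Set ℝ} {B B' B'' : ℝ → ℝ} {x : Point}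

theorem ricci_static (hI : IsOpen I) (hI0 : I ⊆ Set.Ioi 0) (hBpos : ∀ r ∈ I, 0 < B r)
    (hB : ∀ r ∈ I, HasDerivAt B (B' r) r) (hB' : ∀ r ∈ I, HasDerivAt B' (B'' r) r)
    (hx : x ∈ chart I) :
    ricci (staticMetric B) x = blockTensor B (ricciRadial B' B'') (ricciAngular B B') x := by
  have hr : x 1 ≠ 0 := (hI0 hx.1).ne'
  have hs := sin_ne_zero_of_mem_chart hx
  have hb : B (x 1) ≠ 0 := (hBpos _ hx.1).ne'
  have hpd : ∀ m i j k, pd m (christoffel (staticMetric B) i j k) x = ![0,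
      staticChristoffelDr (B (x 1)) (B' (x 1)) (B'' (x 1)) (x 1) (x 2) i j k,
      staticChristoffelDθ (B (x 1)) (x 1) (x 2) i j k, 0] m := fun m i j k =>
    pd_eq_of_hasDerivAt (isOpen_chart hI)
      (F := fun r θ => staticChristoffel (B r) (B' r) r θ i j k)
      (fun y hy => christoffel_static hI0 hBpos hB hy i j k) m hx
      (hasDerivAt_staticChristoffel_r hr hb (hB _ hx.1) (hB' _ hx.1) i j k)
      (hasDerivAt_staticChristoffel_θ hs i j k)
  ext j k
  simp only [ricci, Matrix.of_apply, hpd, christoffel_static hI0 hBpos hB hx, Fin.sum_univ_four]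
  have hsc := Real.sin_sq_add_cos_sq (x 2)
  -- Trigonometric terms survive only through `cos²`; eliminating it leaves rational identities.
  have hc : Real.cos (x 2) ^ 2 = 1 - Real.sin (x 2) ^ 2 := by linarith
  fin_cases j <;> fin_cases k <;>
    simp [blockTensor, ricciRadial, ricciAngular, staticChristoffel, staticChristoffelDr,
      staticChristoffelDθ, Matrix.diagonal] <;>
    field_simp <;> (try rw [hc]) <;> ring

theorem metricTrace_blockTensor {p q : ℝ → ℝ} (hI0 : I ⊆ Set.Ioi 0) (hBpos : ∀ r ∈ I, 0 < B r)
    (hx : x ∈ chart I) :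
    metricTrace (staticMetric B) (blockTensor B p q) x = 2 * (p (x 1) + q (x 1)) := by
  have hr : x 1 ≠ 0 := (hI0 hx.1).ne'
  have hs := sin_ne_zero_of_mem_chart hx
  have hb : B (x 1) ≠ 0 := (hBpos _ hx.1).ne'
  simp [metricTrace, staticMetric_inv hr hs hb, blockTensor, Fin.sum_univ_four, Matrix.diagonal]
  field_simp
  ring

/-- The covariant derivative of a block tensor, where `u = p - q`, `p'` and `q'` are taken
at `r`. -/
def blockCovDeriv (b p' q' u r θ : ℝ) : Fin 4 → Matrix (Fin 4) (Fin 4) ℝ :=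
  ![0,
    Matrix.diagonal ![-(b * p'), p' / b, r ^ 2 * q', r ^ 2 * Real.sin θ ^ 2 * q'],
    !![0, 0, 0, 0; 0, 0, r * u, 0; 0, r * u, 0, 0; 0, 0, 0, 0],
    !![0, 0, 0, 0; 0, 0, 0, r * Real.sin θ ^ 2 * u; 0, 0, 0, 0; 0, r * Real.sin θ ^ 2 * u, 0, 0]]

/-- The metric is parallel, so undifferentiated `p`, `q` enter only through `p - q`, and only when
the connection along the sphere mixes the radial and angular directions. -/
theorem covDeriv₂_blockTensor (hI0 : I ⊆ Set.Ioi 0) (hBpos : ∀ r ∈ I, 0 < B r)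
    (hB : ∀ r ∈ I, HasDerivAt B (B' r) r) (hx : x ∈ chart I) {p q : ℝ → ℝ} {p' q' : ℝ}
    (hp : HasDerivAt p p' (x 1)) (hq : HasDerivAt q q' (x 1)) (j k l : Fin 4) :
    covDeriv₂ (staticMetric B) (blockTensor B p q) j k l x =
      blockCovDeriv (B (x 1)) p' q' (p (x 1) - q (x 1)) (x 1) (x 2) j k l := by
  have hr : x 1 ≠ 0 := (hI0 hx.1).ne'
  have hs := sin_ne_zero_of_mem_chart hx
  have hb : B (x 1) ≠ 0 := (hBpos _ hx.1).ne'
  have hd := hB _ hx.1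
  have hpd : ∀ k l, pd j (fun y => blockTensor B p q y k l) x = ![0,
      Matrix.diagonal ![-(B' (x 1) * p (x 1) + B (x 1) * p'),
        (p' * B (x 1) - p (x 1) * B' (x 1)) / B (x 1) ^ 2,
        2 * x 1 * q (x 1) + x 1 ^ 2 * q', (2 * x 1 * q (x 1) + x 1 ^ 2 * q') * Real.sin (x 2) ^ 2] k l,
      Matrix.diagonal ![0, 0, 0, 2 * x 1 ^ 2 * Real.sin (x 2) * Real.cos (x 2) * q (x 1)] k l, 0] j := by
    intro k l
    have h3 := ((hasDerivAt_id (x 1)).pow 2).mul hq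
    have h5 : HasDerivAt (fun θ => x 1 ^ 2 * Real.sin θ ^ 2 * q (x 1))
        (2 * x 1 ^ 2 * Real.sin (x 2) * Real.cos (x 2) * q (x 1)) (x 2) :=
      ((((Real.hasDerivAt_sin (x 2)).pow 2).const_mul (x 1 ^ 2)).mul_const (q (x 1))).congr_deriv
        (by push_cast; ring)
    have h4 := (((hasDerivAt_id (x 1)).pow 2).mul_const (Real.sin (x 2) ^ 2)).mul hq
    refine pd_eq_of_hasDerivAt isOpen_univ (F := fun r θ => Matrix.diagonal ![-(B r * p r), p r / B r,
      r ^ 2 * q r, r ^ 2 * Real.sin θ ^ 2 * q r] k l) (fun _ _ => rfl) j (Set.mem_univ x) ?_ ?_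
    · fin_cases k <;> fin_cases l <;>
        first
          | exact hasDerivAt_const _ 0
          | exact (hd.mul hp).neg
          | exact hp.div hd hb
          | exact h3.congr_deriv (by simp)
          | exact h4.congr_deriv (by simp; ring)
    · fin_cases k <;> fin_cases l <;>
        first
          | exact hasDerivAt_const _ _
          | exact h5
  simp only [covDeriv₂, christoffel_static hI0 hBpos hB hx, Fin.sum_univ_four, hpd]
  fin_cases j <;> fin_cases k <;> fin_cases l <;>
    simp [blockTensor, blockCovDeriv, staticChristoffel, Matrix.diagonal] <;>
    (try field_simp) <;> (try ring)

/-! ### Faraday tensor and its energy-momentum -/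

/-- The components of the Faraday tensor in the static spherical chart. -/
def faradayMatrix (ε e h r θ : ℝ) : Matrix (Fin 4) (Fin 4) ℝ :=
  !![0, -(ε * e), 0, 0; ε * e, 0, 0, 0; 0, 0, 0, h * r ^ 2 * Real.sin θ;
    0, 0, -(h * r ^ 2 * Real.sin θ), 0]

theorem faradayTensor_eq {ε : ℝ} {E H : ℝ → ℝ} (hBpos : ∀ r ∈ I, 0 < B r) (hx : x ∈ chart I) :
    faradayTensor ε B E H x = faradayMatrix ε (E (x 1)) (H (x 1)) (x 1) (x 2) := by
  have hq : √(B (x 1)) ≠ 0 := (Real.sqrt_pos.2 (hBpos _ hx.1)).ne'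
  ext j k
  fin_cases j <;> fin_cases k <;>
    simp [faradayTensor, faradayMatrix, velocity, radial, angularY, angularZ] <;> field_simp

/-- The electric and magnetic parts live on complementary blocks and contribute alike; the sign
enters only as `ε² = 1`. -/
theorem linearEM_faradayTensor {ε : ℝ} (hε : ε = 1 ∨ ε = -1) {E H : ℝ → ℝ} (hI0 : I ⊆ Set.Ioi 0)
    (hBpos : ∀ r ∈ I, 0 < B r) (hx : x ∈ chart I) :
    linearEM (staticMetric B) (faradayTensor ε B E H) x =
      blockTensor B (fun r => -(E r ^ 2 + H r ^ 2)) (fun r => E r ^ 2 + H r ^ 2) x := by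
  have hr : x 1 ≠ 0 := (hI0 hx.1).ne'
  have hs := sin_ne_zero_of_mem_chart hx
  have hb : B (x 1) ≠ 0 := (hBpos _ hx.1).ne'
  have hee : ε ^ 2 = 1 := by rcases hε with h | h <;> simp [h]
  ext j k
  simp only [linearEM, fieldInvariant, Matrix.of_apply, staticMetric_inv hr hs hb,
    faradayTensor_eq hBpos hx,
    Fin.sum_univ_four]
  fin_cases j <;> fin_cases k <;>
    simp [faradayMatrix, blockTensor, staticMetric, Matrix.diagonal] <;>
    field_simp <;> (try simp only [hee]) <;> ring

end

/-! ### Reduction of the field equations to the radial variable -/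

section

variable {I : Set ℝ} {B B' : ℝ → ℝ}

theorem mem_chart_equator {r : ℝ} (hr : r ∈ I) : (![0, r, Real.pi / 2, 0] : Point) ∈ chart I :=
  ⟨hr, half_pos Real.pi_pos, half_lt_self Real.pi_pos⟩

/-- The Christoffel terms cancel in the cyclic sum, which is `dF`. The electric part is closed for
every `E(r)`; the only condition is `∂_r (r² H sin θ) = 0`. -/
theorem isFaraday_static_iff {ε : ℝ} {E H E' H' : ℝ → ℝ} (hI : IsOpen I) (hI0 : I ⊆ Set.Ioi 0)
    (hBpos : ∀ r ∈ I, 0 < B r) (hB : ∀ r ∈ I, HasDerivAt B (B' r) r)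
    (hE : ∀ r ∈ I, HasDerivAt E (E' r) r) (hH : ∀ r ∈ I, HasDerivAt H (H' r) r) :
    IsFaraday (staticMetric B) (faradayTensor ε B E H) (chart I) ↔
      ∀ r ∈ I, H' r * r ^ 2 + H r * (2 * r) = 0 := by
  have hpd : ∀ x ∈ chart I, ∀ j k l, pd j (fun y => faradayTensor ε B E H y k l) x = ![0,
      !![0, -(ε * E' (x 1)), 0, 0; ε * E' (x 1), 0, 0, 0;
        0, 0, 0, (H' (x 1) * x 1 ^ 2 + H (x 1) * (2 * x 1)) * Real.sin (x 2);
        0, 0, -((H' (x 1) * x 1 ^ 2 + H (x 1) * (2 * x 1)) * Real.sin (x 2)), 0] k l,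
      !![0, 0, 0, 0; 0, 0, 0, 0; 0, 0, 0, H (x 1) * x 1 ^ 2 * Real.cos (x 2);
        0, 0, -(H (x 1) * x 1 ^ 2 * Real.cos (x 2)), 0] k l, 0] j := by
    intro x hx j k l
    have h1 := (hE _ hx.1).const_mul ε
    have h2 : HasDerivAt (fun r => H r * r ^ 2 * Real.sin (x 2))
        ((H' (x 1) * x 1 ^ 2 + H (x 1) * (2 * x 1)) * Real.sin (x 2)) (x 1) :=
      (((hH _ hx.1).mul ((hasDerivAt_id (x 1)).pow 2)).mul_const _).congr_deriv (by simp)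
    have h3 := (Real.hasDerivAt_sin (x 2)).const_mul (H (x 1) * x 1 ^ 2)
    refine pd_eq_of_hasDerivAt (isOpen_chart hI)
      (F := fun r θ => faradayMatrix ε (E r) (H r) r θ k l)
      (fun y hy => by rw [faradayTensor_eq hBpos hy]) j hx ?_ ?_
    · fin_cases k <;> fin_cases l <;>
        first
          | exact hasDerivAt_const _ 0
          | exact h1
          | exact h1.neg
          | exact h2
          | exact h2.neg
    · fin_cases k <;> fin_cases l <;>
        first
          | exact hasDerivAt_const _ _
          | exact h3
          | exact h3.neg
  constructor
  · intro h r hr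
    have hx := mem_chart_equator hr
    have := h _ hx 1 2 3
    simp only [covDeriv₂, hpd _ hx, christoffel_static hI0 hBpos hB hx, Fin.sum_univ_four,
      faradayTensor_eq hBpos hx] at this
    simpa [faradayMatrix, staticChristoffel] using this
  · intro h x hx j k l
    have hr : x 1 ≠ 0 := (hI0 hx.1).ne'
    have hs := sin_ne_zero_of_mem_chart hx
    simp only [covDeriv₂, hpd _ hx, christoffel_static hI0 hBpos hB hx, Fin.sum_univ_four,
      faradayTensor_eq hBpos hx, h _ hx.1]
    fin_cases j <;> fin_cases k <;> fin_cases l <;>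
      simp [faradayMatrix, staticChristoffel]

/-- The two conditions are `α' = 0` and `r β' = α - β` for the eigenvalues of the Codazzi tensor,
multiplied by 3. -/
theorem solvesHarada_block_iff {T : Tensor₂} {P Q w P' Q' w' : ℝ → ℝ}
    (hI : IsOpen I) (hI0 : I ⊆ Set.Ioi 0)
    (hBpos : ∀ r ∈ I, 0 < B r) (hB : ∀ r ∈ I, HasDerivAt B (B' r) r)
    (hRic : ∀ x ∈ chart I, ricci (staticMetric B) x = blockTensor B P Q x)
    (hT : ∀ x ∈ chart I, T x = blockTensor B (fun r => -w r) w x)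
    (hP : ∀ r ∈ I, HasDerivAt P (P' r) r) (hQ : ∀ r ∈ I, HasDerivAt Q (Q' r) r)
    (hw : ∀ r ∈ I, HasDerivAt w (w' r) r) :
    SolvesHarada (staticMetric B) T (chart I) ↔
      ∀ r ∈ I, 2 * P' r - Q' r + 3 * w' r = 0 ∧
        r * (2 * Q' r - P' r - 3 * w' r) = 3 * (P r - Q r + 2 * w r) := by
  have hU := isOpen_chart hI
  have htr {S : Tensor₂} {p q p' q' : ℝ → ℝ} (hS : ∀ x ∈ chart I, S x = blockTensor B p q x)
      (hp : ∀ r ∈ I, HasDerivAt p (p' r) r) (hq : ∀ r ∈ I, HasDerivAt q (q' r) r)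
      (x : Point) (hx : x ∈ chart I) (j : Fin 4) :
      pd j (metricTrace (staticMetric B) S) x = ![0, 2 * (p' (x 1) + q' (x 1)), 0, 0] j := by
    refine pd_eq_of_hasDerivAt hU (F := fun r _ => 2 * (p r + q r)) (fun y hy => ?_) j hx
      (((hp _ hx.1).add (hq _ hx.1)).const_mul 2) (hasDerivAt_const _ _)
    rw [← metricTrace_blockTensor hI0 hBpos hy, metricTrace, metricTrace, hS y hy]
  have hw_neg : ∀ r ∈ I, HasDerivAt (fun r => -w r) (-w' r) r := fun r hr => (hw r hr).neg
  have hcov {S : Tensor₂} {p q p' q' : ℝ → ℝ} (hS : ∀ x ∈ chart I, S x = blockTensor B p q x)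
      (hp : ∀ r ∈ I, HasDerivAt p (p' r) r) (hq : ∀ r ∈ I, HasDerivAt q (q' r) r)
      (x : Point) (hx : x ∈ chart I) (j k l : Fin 4) :
      covDeriv₂ (staticMetric B) S j k l x =
        blockCovDeriv (B (x 1)) (p' (x 1)) (q' (x 1)) (p (x 1) - q (x 1)) (x 1) (x 2) j k l := by
    rw [covDeriv₂_congr hU _ hS j k l hx,
      covDeriv₂_blockTensor hI0 hBpos hB hx (hp _ hx.1) (hq _ hx.1)]
  simp only [SolvesHarada, cotton]
  constructor
  · intro h r hr
    have hx := mem_chart_equator hr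
    have hr0 : r ≠ 0 := (hI0 hr).ne'
    have hb : B r ≠ 0 := (hBpos _ hr).ne'
    -- These two components carry all the information; at the equator `sin θ = 1`.
    have h1 := h _ hx 1 0 0
    have h2 := h _ hx 1 2 2
    simp only [hcov hRic hP hQ _ hx, hcov hT hw_neg hw _ hx, htr hRic hP hQ _ hx,
      htr hT hw_neg hw _ hx] at h1 h2
    simp [blockCovDeriv, staticMetric, Matrix.diagonal] at h1 h2
    constructor
    · apply mul_left_cancel₀ hb
      linear_combination -3 * h1
    · apply mul_left_cancel₀ hr0
      linear_combination 3 * h2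
  · intro h x hx j k l
    have hr0 : x 1 ≠ 0 := (hI0 hx.1).ne'
    have hb : B (x 1) ≠ 0 := (hBpos _ hx.1).ne'
    obtain ⟨h1, h2⟩ := h _ hx.1
    simp only [hcov hRic hP hQ _ hx, hcov hT hw_neg hw _ hx, htr hRic hP hQ _ hx,
      htr hT hw_neg hw _ hx]
    -- Solving the two conditions for `Q'` and `P` makes every component an identity.
    have hQ' : Q' (x 1) = 2 * P' (x 1) + 3 * w' (x 1) := by linarith
    have hP0 : P (x 1) = Q (x 1) - 2 * w (x 1) + x 1 * (P' (x 1) + w' (x 1)) := by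
      rw [hQ'] at h2
      linarith
    rw [hQ', hP0]
    fin_cases j <;> fin_cases k <;> fin_cases l <;>
      simp [blockCovDeriv, staticMetric, Matrix.diagonal] <;> (try field_simp) <;> (try ring)

end

/-! ### Constancy from differential identities -/

theorem exists_eq_const_of_hasDerivAt_zero {I : Set ℝ} (hI : IsOpen I) (hIc : IsPreconnected I)
    {f : ℝ → ℝ} (hf : ∀ r ∈ I, HasDerivAt f 0 r) : ∃ a, ∀ r ∈ I, f r = a :=
  hI.exists_is_const_of_deriv_eq_zero hIc
    (fun r hr => (hf r hr).differentiableAt.differentiableWithinAt) fun r hr => (hf r hr).deriv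

/-- On an open preconnected set, a differentiable function with constant square is constant. -/
theorem exists_eq_const_of_sq_eq_const {I : Set ℝ} (hI : IsOpen I) (hIc : IsPreconnected I)
    {f f' : ℝ → ℝ} (hf : ∀ r ∈ I, HasDerivAt f (f' r) r) {K : ℝ} (hK : ∀ r ∈ I, f r ^ 2 = K) :
    ∃ a, ∀ r ∈ I, f r = a := by
  -- For `K ≠ 0`, `2 f f' = 0` can be divided by `f`; for `K = 0` the function itself vanishes.
  by_cases hK0 : K = 0
  · exact ⟨0, fun r hr => by simpa [hK0] using hK r hr⟩
  refine exists_eq_const_of_hasDerivAt_zero hI hIc fun r hr => (hf r hr).congr_deriv ?_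
  have h1 : HasDerivAt (fun s => f s ^ 2) 0 r :=
    (hasDerivAt_const r K).congr_of_eventuallyEq (by filter_upwards [hI.mem_nhds hr] using hK)
  have h2 := h1.unique ((hf r hr).pow 2)
  have hfr : f r ≠ 0 := fun h => hK0 (by simpa [h] using (hK r hr).symm)
  simpa [hfr] using h2

theorem HasDerivAt.eq_of_eqOn {I : Set ℝ} (hI : IsOpen I) {f g : ℝ → ℝ} (hfg : ∀ r ∈ I, f r = g r)
    {r a b : ℝ} (hr : r ∈ I) (hf : HasDerivAt f a r) (hg : HasDerivAt g b r) : a = b :=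
  hf.unique (hg.congr_of_eventuallyEq (by filter_upwards [hI.mem_nhds hr] using hfg))

theorem hasDerivAt_deriv_of_contDiffOn {I : Set ℝ} (hI : IsOpen I) {f : ℝ → ℝ} {n : WithTop ℕ∞}
    (hf : ContDiffOn ℝ n f I) (hn : n ≠ 0) (r : ℝ) (hr : r ∈ I) : HasDerivAt f (deriv f r) r :=
  ((hf.differentiableOn hn).differentiableAt (hI.mem_nhds hr)).hasDerivAt

/-! ### Integration of the reduced equations -/

section

variable {I : Set ℝ} {B B' B'' B''' : ℝ → ℝ}

theorem hasDerivAt_ricciRadial {r b''' : ℝ} (hr : r ≠ 0) (hB' : HasDerivAt B' (B'' r) r)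
    (hB'' : HasDerivAt B'' b''' r) :
    HasDerivAt (ricciRadial B' B'') (-(b''' / 2) - (B'' r * r - B' r) / r ^ 2) r :=
  ((hB''.div_const 2).neg.sub (hB'.div (hasDerivAt_id r) hr)).congr_deriv (by simp)

theorem hasDerivAt_ricciAngular {r : ℝ} (hr : r ≠ 0) (hB : HasDerivAt B (B' r) r)
    (hB' : HasDerivAt B' (B'' r) r) :
    HasDerivAt (ricciAngular B B')
      (-(2 * B' r + r * B'' r) / r ^ 2 - 2 * (1 - B r - r * B' r) / r ^ 3) r := by
  refine (((hB.const_sub 1).sub ((hasDerivAt_id r).mul hB')).div ((hasDerivAt_id r).pow 2)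
    (pow_ne_zero 2 hr)).congr_deriv ?_
  simp
  field_simp
  ring

/-- The general solution of the Harada equation with a source of energy density `w`. -/
theorem exists_metric_coefficients (hI : IsOpen I) (hIc : IsPreconnected I) (hI0 : I ⊆ Set.Ioi 0)
    {w P' Q' w' : ℝ → ℝ}
    (hB : ∀ r ∈ I, HasDerivAt B (B' r) r) (hB' : ∀ r ∈ I, HasDerivAt B' (B'' r) r)
    (hP : ∀ r ∈ I, HasDerivAt (ricciRadial B' B'') (P' r) r)
    (hQ : ∀ r ∈ I, HasDerivAt (ricciAngular B B') (Q' r) r)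
    (hw : ∀ r ∈ I, HasDerivAt w (w' r) r)
    (h : ∀ r ∈ I, 2 * P' r - Q' r + 3 * w' r = 0 ∧
      r * (2 * Q' r - P' r - 3 * w' r) =
        3 * (ricciRadial B' B'' r - ricciAngular B B' r + 2 * w r)) :
    ∃ p c a b : ℝ, ∀ r ∈ I, B r = 1 - p * r ^ 2 - c * r + a / r + b / r ^ 2 ∧ w r = b / r ^ 4 := by
  -- The radial eigenvalue `α` is constant.
  obtain ⟨p, hp⟩ := exists_eq_const_of_hasDerivAt_zero hI hIc
    (f := fun r => (2 * ricciRadial B' B'' r - ricciAngular B B' r + 3 * w r) / 3)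
    fun r hr => (((((hP r hr).const_mul 2).sub (hQ r hr)).add ((hw r hr).const_mul 3)).div_const
      3).congr_deriv (by rw [(h r hr).1, zero_div])
  -- The second condition says `(r (β - p))' = 0`.
  obtain ⟨c, hc⟩ := exists_eq_const_of_hasDerivAt_zero hI hIc
    (f := fun r => r * ((2 * ricciAngular B B' r - ricciRadial B' B'' r - 3 * w r) / 3 - p))
    fun r hr => ((hasDerivAt_id r).mul ((((((hQ r hr).const_mul 2).sub (hP r hr)).sub
      ((hw r hr).const_mul 3)).div_const 3).sub_const p)).congr_deriv (by
        have h1 := hp r hr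
        have h2 := (h r hr).2
        simp only [Pi.sub_apply, id] at h1 ⊢
        linear_combination h2 / 3 + h1)
  -- From `α + β = 2p + c/r`, where `w` has cancelled; the left side contains `(r² B)''`.
  have hBeq : ∀ r ∈ I, 2 * B r + 4 * r * B' r + r ^ 2 * B'' r - 2 + 12 * p * r ^ 2 + 6 * c * r = 0 := by
    intro r hr
    have hr0 : r ≠ 0 := (hI0 hr).ne'
    have hR : 2 * B r + 4 * r * B' r + r ^ 2 * B'' r - 2 =
        -(2 * r ^ 2 * (ricciRadial B' B'' r + ricciAngular B B' r)) := by
      simp only [ricciRadial, ricciAngular]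
      field_simp
      ring
    linear_combination hR - 6 * r ^ 2 * hp r hr - 6 * r * hc r hr
  -- First integral: `(r² B)'` and the primitives of the remaining terms.
  obtain ⟨a, ha⟩ := exists_eq_const_of_hasDerivAt_zero hI hIc
    (f := fun r => 2 * r * B r + r ^ 2 * B' r - 2 * r + 4 * p * r ^ 3 + 3 * c * r ^ 2)
    fun r hr => by
      have hid := hasDerivAt_id r
      refine ((((((hid.const_mul 2).mul (hB r hr)).add ((hid.pow 2).mul (hB' r hr))).sub
        (hid.const_mul 2)).add ((hid.pow 3).const_mul (4 * p))).add
        ((hid.pow 2).const_mul (3 * c))).congr_deriv ?_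
      have := hBeq r hr
      simp
      linear_combination this
  obtain ⟨b, hb⟩ := exists_eq_const_of_hasDerivAt_zero hI hIc
    (f := fun r => r ^ 2 * B r - r ^ 2 + p * r ^ 4 + c * r ^ 3 - a * r)
    fun r hr => by
      have hid := hasDerivAt_id r
      refine ((((((hid.pow 2).mul (hB r hr)).sub (hid.pow 2)).add
        ((hid.pow 4).const_mul p)).add ((hid.pow 3).const_mul c)).sub
        (hid.const_mul a)).congr_deriv ?_
      have := ha r hr
      simp
      linear_combination this
  refine ⟨p, c, a, b, fun r hr => ?_⟩
  have hr0 : r ≠ 0 := (hI0 hr).ne'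
  have hBr : B r = 1 - p * r ^ 2 - c * r + a / r + b / r ^ 2 := by
    have := hb r hr
    field_simp
    linear_combination this
  have hB'r : B' r = -(2 * p * r) - c - a / r ^ 2 - 2 * b / r ^ 3 := by
    have := ha r hr
    simp only [hBr] at this
    field_simp at this ⊢
    linear_combination this
  have hB''r : B'' r = -(2 * p) + 2 * a / r ^ 3 + 6 * b / r ^ 4 := by
    have := hBeq r hr
    simp only [hBr, hB'r] at this
    field_simp at this ⊢
    linear_combination this
  refine ⟨hBr, ?_⟩
  -- With `B` known, `α = p` determines `w`.
  have := hp r hr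
  simp only [ricciRadial, ricciAngular, hBr, hB'r, hB''r] at this
  field_simp at this ⊢
  linear_combination this / 3

/-- The metric functions of the solution with charge `b` satisfy the reduced Harada equation. -/
theorem reduced_harada_of_eq (hI : IsOpen I) (hI0 : I ⊆ Set.Ioi 0) {w P' Q' w' : ℝ → ℝ}
    (hB : ∀ r ∈ I, HasDerivAt B (B' r) r) (hB' : ∀ r ∈ I, HasDerivAt B' (B'' r) r)
    (hB'' : ∀ r ∈ I, HasDerivAt B'' (B''' r) r)
    (hP : ∀ r ∈ I, HasDerivAt (ricciRadial B' B'') (P' r) r)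
    (hQ : ∀ r ∈ I, HasDerivAt (ricciAngular B B') (Q' r) r)
    (hw : ∀ r ∈ I, HasDerivAt w (w' r) r) {p c a b : ℝ}
    (hBr : ∀ r ∈ I, B r = 1 - p * r ^ 2 - c * r + a / r + b / r ^ 2)
    (hwr : ∀ r ∈ I, w r = b / r ^ 4) {r : ℝ} (hr : r ∈ I) :
    2 * P' r - Q' r + 3 * w' r = 0 ∧
      r * (2 * Q' r - P' r - 3 * w' r) =
        3 * (ricciRadial B' B'' r - ricciAngular B B' r + 2 * w r) := by
  have hinv (k : ℝ) (n : ℕ) (s : ℝ) (hs : s ∈ I) :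
      HasDerivAt (fun s => k / s ^ n) (-(n * k / s ^ (n + 1))) s := by
    have hs0 : s ≠ 0 := (hI0 hs).ne'
    refine ((hasDerivAt_const s k).div (hasDerivAt_pow n s) (pow_ne_zero n hs0)).congr_deriv ?_
    rcases n with _ | n
    · simp
    · simp
      field_simp
      ring
  have hpow (k : ℝ) (s : ℝ) : HasDerivAt (fun s => k * s ^ 2) (2 * k * s) s :=
    ((hasDerivAt_pow 2 s).const_mul k).congr_deriv (by simp; ring)
  have hlin (k : ℝ) (s : ℝ) : HasDerivAt (fun s => k * s) k s :=
    ((hasDerivAt_id s).const_mul k).congr_deriv (by simp)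
  have hB'r : ∀ s ∈ I, B' s = -(2 * p * s) - c - a / s ^ 2 - 2 * b / s ^ 3 := fun s hs => by
    -- `a / s ^ 1` puts this term in the form covered by `hinv`.
    refine HasDerivAt.eq_of_eqOn hI (g := fun s => 1 - p * s ^ 2 - c * s + a / s ^ 1 + b / s ^ 2)
      (fun r hr => by rw [hBr r hr, pow_one]) hs (hB s hs) ?_
    refine (((((hpow p s).const_sub 1).sub (hlin c s)).add (hinv a 1 s hs)).add
      (hinv b 2 s hs)).congr_deriv ?_
    push_cast; ring
  have hB''r : ∀ s ∈ I, B'' s = -(2 * p) + 2 * a / s ^ 3 + 6 * b / s ^ 4 := fun s hs => by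
    refine HasDerivAt.eq_of_eqOn hI hB'r hs (hB' s hs) ?_
    refine (((((hlin (2 * p) s).neg).sub_const c).sub (hinv a 2 s hs)).sub
      (hinv (2 * b) 3 s hs)).congr_deriv ?_
    push_cast; ring
  have hB'''r : B''' r = -(6 * a / r ^ 4) - 24 * b / r ^ 5 := by
    refine HasDerivAt.eq_of_eqOn hI hB''r hr (hB'' r hr) ?_
    refine (((hinv (2 * a) 3 r hr).const_add (-(2 * p))).add (hinv (6 * b) 4 r hr)).congr_deriv ?_
    push_cast; ring
  have hw'r : w' r = -(4 * b / r ^ 5) :=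
    HasDerivAt.eq_of_eqOn hI hwr hr (hw r hr) ((hinv b 4 r hr).congr_deriv (by push_cast; ring))
  have hr0 : r ≠ 0 := (hI0 hr).ne'
  rw [(hP r hr).unique (hasDerivAt_ricciRadial hr0 (hB' r hr) (hB'' r hr)),
    (hQ r hr).unique (hasDerivAt_ricciAngular hr0 (hB r hr) (hB' r hr)), hw'r, hwr r hr,
    ricciRadial, ricciAngular, hBr r hr, hB'r r hr, hB''r r hr, hB'''r]
  constructor <;> field_simp <;> ring

end

end CottonGravity

end

/-! ### The equivalence -/

theorem mainTheorem9 (I : Set ℝ) (hI : IsOpen I) (hIc : IsPreconnected I) (hI0 : I ⊆ Set.Ioi 0)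
    (B E H : ℝ → ℝ) (hB : ContDiffOn ℝ 3 B I) (hE : ContDiffOn ℝ 1 E I) (hH : ContDiffOn ℝ 1 H I)
    (hBpos : ∀ r ∈ I, 0 < B r) (ε : ℝ) (hε : ε = 1 ∨ ε = -1) :
    (IsFaraday (staticMetric B) (faradayTensor ε B E H) (chart I) ∧
      SolvesHarada (staticMetric B) (linearEM (staticMetric B) (faradayTensor ε B E H)) (chart I)) ↔
    ∃ qe qm M Λ γ : ℝ, ∀ r ∈ I,
      E r = qe / r ^ 2 ∧ H r = qm / r ^ 2 ∧
      B r = 1 - 2 * M / r - Λ / 3 * r ^ 2 + γ * r + (qe ^ 2 + qm ^ 2) / r ^ 2 := by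
  have hBc' : ContDiffOn ℝ 2 (deriv B) I := hB.deriv_of_isOpen hI (by norm_num)
  have hBc'' : ContDiffOn ℝ 1 (deriv (deriv B)) I := hBc'.deriv_of_isOpen hI (by norm_num)
  have hB1 := hasDerivAt_deriv_of_contDiffOn hI hB (by norm_num)
  have hB2 := hasDerivAt_deriv_of_contDiffOn hI hBc' (by norm_num)
  have hB3 := hasDerivAt_deriv_of_contDiffOn hI hBc'' (by norm_num)
  have hE1 := hasDerivAt_deriv_of_contDiffOn hI hE (by norm_num)
  have hH1 := hasDerivAt_deriv_of_contDiffOn hI hH (by norm_num)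
  -- Going through `differentiableAt` makes the derivative a plain `deriv`; its explicit value is
  -- recovered by uniqueness in `reduced_harada_of_eq`.
  have hP : ∀ r ∈ I, HasDerivAt (ricciRadial (deriv B) (deriv (deriv B))) _ r := fun r hr =>
    (hasDerivAt_ricciRadial (hI0 hr).ne' (hB2 r hr) (hB3 r hr)).differentiableAt.hasDerivAt
  have hQ : ∀ r ∈ I, HasDerivAt (ricciAngular B (deriv B)) _ r := fun r hr =>
    (hasDerivAt_ricciAngular (hI0 hr).ne' (hB1 r hr) (hB2 r hr)).differentiableAt.hasDerivAt
  have hw : ∀ r ∈ I, HasDerivAt (fun r => E r ^ 2 + H r ^ 2) _ r := fun r hr =>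
    ((hE1 r hr).pow 2).add ((hH1 r hr).pow 2)
  rw [isFaraday_static_iff hI hI0 hBpos hB1 hE1 hH1, solvesHarada_block_iff hI hI0 hBpos hB1
    (fun x hx => ricci_static hI hI0 hBpos hB1 hB2 hx)
    (fun x hx => linearEM_faradayTensor (E := E) (H := H) hε hI0 hBpos hx) hP hQ hw]
  have hsq (f : ℝ → ℝ) (hf : ∀ r ∈ I, HasDerivAt f (deriv f r) r) (r : ℝ) (hr : r ∈ I) :
      HasDerivAt (fun r => f r * r ^ 2) (deriv f r * r ^ 2 + f r * (2 * r)) r :=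
    ((hf r hr).mul ((hasDerivAt_id r).pow 2)).congr_deriv (by simp)
  constructor
  · rintro ⟨hF, hC⟩
    obtain ⟨qm, hqm⟩ := exists_eq_const_of_hasDerivAt_zero hI hIc
      fun r hr => (hsq H hH1 r hr).congr_deriv (hF r hr)
    obtain ⟨p, c, a, b, hsol⟩ := exists_metric_coefficients hI hIc hI0 hB1 hB2 hP hQ hw hC
    have hK : ∀ r ∈ I, (E r * r ^ 2) ^ 2 = b - qm ^ 2 := fun r hr => by
      have hr0 : r ≠ 0 := (hI0 hr).ne'
      have h1 := (hsol r hr).2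
      rw [← hqm r hr]
      field_simp at h1
      linear_combination h1
    obtain ⟨qe, hqe⟩ := exists_eq_const_of_sq_eq_const hI hIc (hsq E hE1) hK
    -- Matching `1 - p r² - c r + a/r` with the stated form of `B`.
    refine ⟨qe, qm, -a / 2, 3 * p, -c, fun r hr => ?_⟩
    have hr0 : r ≠ 0 := (hI0 hr).ne'
    have hb : qe ^ 2 + qm ^ 2 = b := by rw [← hqe r hr, hK r hr]; ring
    refine ⟨by rw [← hqe r hr]; field_simp, by rw [← hqm r hr]; field_simp, ?_⟩
    rw [hb, (hsol r hr).1]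
    ring
  · rintro ⟨qe, qm, M, Λ, γ, h⟩
    constructor
    · intro r hr
      have hc : ∀ s ∈ I, H s * s ^ 2 = qm := fun s hs => by
        have hs0 : s ≠ 0 := (hI0 hs).ne'
        rw [(h s hs).2.1]
        field_simp
      exact HasDerivAt.eq_of_eqOn hI hc hr (hsq H hH1 r hr) (hasDerivAt_const r qm)
    · intro r hr
      refine reduced_harada_of_eq hI hI0 hB1 hB2 hB3 hP hQ hw (p := Λ / 3) (c := -γ) (a := -(2 * M))
        (b := qe ^ 2 + qm ^ 2) (fun s hs => ?_) (fun s hs => ?_) hr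
      · rw [(h s hs).2.2]
        ring
      · rw [(h s hs).1, (h s hs).2.1]
        ring
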